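/- Theorem (Maximum Entropy Theorem for Complex-Valued Random Vectors II). Let $\mathbf{x}$ be a random vector in $\mathbb{C}^n$ with finite second-order moments such that the distribution of its real representation $\mathbf{x}^{(\mathrm r)} = [\Re\{\mathbf{x}^T\}\ \Im\{\mathbf{x}^T\}]^T \in \mathbb{R}^{2n}$ is absolutely continuous with respect to Lebesgue measure, with density $f$. Let $\mathbf{m} = E\{\mathbf{x}\}$, let $\mathbf{C}_{\mathbf{x}} = E\{(\mathbf{x}-\mathbf{m})(\mathbf{x}-\mathbf{m})^H\}$ be its covariance matrix and $\mathbf{P}_{\mathbf{x}} = E\{(\mathbf{x}-\mathbf{m})(\mathbf{x}-\mathbf{m})^T\}$ its complementary covariance matrix. Suppose that $\mathbf{C}_{\mathbf{x}}$ is non-singular, let $\mathbf{B}$ be any generalized Cholesky factor of $\mathbf{C}_{\mathbf{x}}$, i.e. any $\mathbf{B} \in \mathbb{C}^{n\times n}$ with $\mathbf{C}_{\mathbf{x}} = \mathbf{B}\mathbf{B}^H$, and suppose that $\|\mathbf{B}^{-1}\mathbf{P}_{\mathbf{x}}\mathbf{B}^{-T}\|_2 < 1$, where $\|\cdot\|_2$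 is the Euclidean operator norm. Let $\lambda_1,\dots,\lambda_n$ be the singular values of $\mathbf{B}^{-1}\mathbf{P}_{\mathbf{x}}\mathbf{B}^{-T}$, and let $\log$ be the logarithm to an arbitrary fixed base $b > 1$. The differential entropy of $\mathbf{x}$ is $$h(\mathbf{x}) = -\int_{\mathbb{R}^{2n}} f(\boldsymbol\xi)\log f(\boldsymbol\xi)\,d\boldsymbol\xi \qquad (0 \log 0 = 0),$$ and it is said to exist if the integrand is integrable. If $h(\mathbf{x})$ exists, then $$h(\mathbf{x}) \le \log\det(\pi e\,\mathbf{C}_{\mathbf{x}}) + \frac12\sum_{i=1}^n \log(1-\lambda_i^2).$$ Moreover, $h(\mathbf{x})$ exists and equality holds if and only if $\mathbf{x}$ is Gaussian distributed, i.e. $\mathbf{x}^{(\mathrm r)}$ is multivariate Gaussian. -/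

import Mathlib

open MeasureTheory ProbabilityTheory
open scoped Matrix ComplexConjugate ComplexOrder

noncomputable section

namespace ComplexRV

variable {Ω : Type*} [MeasurableSpace Ω] {n : ℕ}

/-- The real representation `x^(r) = [Re x^T, Im x^T]^T ∈ ℝ^{2n}` of a complex-valued random
vector `x ∈ ℂ^n`; the index type `Fin n ⊕ Fin n` lists the real parts, then the imaginary parts. -/
def realRep (X : Ω → Fin n → ℂ) (ω : Ω) : Fin n ⊕ Fin n → ℝ :=
  Sum.elim (fun i => (X ω i).re) (fun i => (X ω i).im)

/-- The mean vector `m_x = E[x]`. -/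
def meanVec (X : Ω → Fin n → ℂ) (P : Measure Ω) : Fin n → ℂ :=
  fun i => ∫ ω, X ω i ∂P

/-- The covariance matrix `C_x = E[(x - m_x)(x - m_x)^H]`. -/
def covMat (X : Ω → Fin n → ℂ) (P : Measure Ω) : Matrix (Fin n) (Fin n) ℂ :=
  Matrix.of fun i j => ∫ ω, (X ω i - meanVec X P i) * conj (X ω j - meanVec X P j) ∂P

/-- The complementary covariance matrix `P_x = E[(x - m_x)(x - m_x)^T]`. -/
def compCovMat (X : Ω → Fin n → ℂ) (P : Measure Ω) : Matrix (Fin n) (Fin n) ℂ :=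
  Matrix.of fun i j => ∫ ω, (X ω i - meanVec X P i) * (X ω j - meanVec X P j) ∂P

/-- `B` is a generalized Cholesky factor of the positive definite Hermitian matrix `A`. -/
def IsGenCholeskyFactor (B A : Matrix (Fin n) (Fin n) ℂ) : Prop :=
  A.PosDef ∧ A = B * Bᴴ

/-- The matrix `B⁻¹ P B⁻ᵀ`. -/
def coherenceMat (B P : Matrix (Fin n) (Fin n) ℂ) : Matrix (Fin n) (Fin n) ℂ :=
  B⁻¹ * P * (B⁻¹)ᵀ

/-- The Euclidean operator norm `‖A‖₂` of a complex square matrix. -/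
def euclOpNorm (A : Matrix (Fin n) (Fin n) ℂ) : ℝ :=
  ‖Matrix.toEuclideanCLM (n := Fin n) (𝕜 := ℂ) A‖

/-- The `n` singular values of a complex `n × n` matrix, with multiplicity. -/
def singVal (A : Matrix (Fin n) (Fin n) ℂ) (i : Fin n) : ℝ :=
  (Matrix.toEuclideanLin A).singularValues i

/-- The integrand `f log_b f` of the differential entropy, where `f` is the probability density
function of `x^(r)` with respect to the Lebesgue measure on `ℝ^{2n}`. Here `0 log 0 = 0`. -/
def entropyIntegrand (b : ℝ) (X : Ω → Fin n → ℂ) (P : Measure Ω) (ξ : Fin n ⊕ Fin n → ℝ) : ℝ :=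
  (pdf (realRep X) P volume ξ).toReal * Real.logb b (pdf (realRep X) P volume ξ).toReal

/-- The differential entropy of `x` is defined: its integrand is integrable. -/
def HasEntropy (b : ℝ) (X : Ω → Fin n → ℂ) (P : Measure Ω) : Prop :=
  Integrable (entropyIntegrand b X P) volume

/-- The differential entropy `h(x) = -∫ f log_b f`, meaningful when `HasEntropy b X P` holds. -/
def entropy (b : ℝ) (X : Ω → Fin n → ℂ) (P : Measure Ω) : ℝ :=
  -∫ ξ, entropyIntegrand b X P ξ

/-- `x` is Gaussian distributed: its real representation is multivariate Gaussian. -/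
def IsGaussianVec (X : Ω → Fin n → ℂ) (P : Measure Ω) : Prop :=
  HasGaussianLaw (realRep X) P

/-- The bound `log_b det (π e C_x) + ½ ∑ log_b (1 - λ_i²)`, the `λ_i` being the singular values
of `B⁻¹ P_x B⁻ᵀ`. The determinant of the covariance matrix is a real number, so that taking
its real part only changes its type. -/
def entropyBound (b : ℝ) (X : Ω → Fin n → ℂ) (P : Measure Ω) (B : Matrix (Fin n) (Fin n) ℂ) : ℝ :=
  Real.logb b (((Real.pi * Real.exp 1 : ℝ) : ℂ) • covMat X P).det.re
    + 1 / 2 * ∑ i : Fin n, Real.logb b (1 - singVal (coherenceMat B (compCovMat X P)) i ^ 2)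

end ComplexRV

end

/-! Since x and its real representation carry the same data, this is a real maximum entropy problem
in dimension 2n. Write the real covariance matrix as `A * Aᵀ` and let g be the density of the
Gaussian law with the same mean and covariance. As log g is a quadratic polynomial, ∫ f log g
depends only on the first two moments, so it has the same value, minus the Gaussian entropy, for
every admissible f. Gibbs' inequality (`gibbs`) gives ∫ f log g ≤ ∫ f log f, with equality only if f
= g almost everywhere; this is `real_maximum_entropy`.

It remains to compute the real covariance determinant. Passing from x^(r) to [x; conj x] turns the
real covariance into the augmented covariance (`det_ofReal_eq`), at the cost of a factor 4^n. Block
factorization through B reduces the latter to [[1, K], [Kᴴ, 1]] with K = B⁻¹ P_x B⁻ᵀ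
(`det_augmented`), whose determinant is det(1 - KᴴK) = ∏ (1 - λ_i²). The condition ‖K‖₂ < 1 makes
every factor positive. -/

noncomputable section

namespace ComplexRV

/-! ### Gibbs' inequality for densities. -/

section Gibbs

variable {α : Type*} {mα : MeasurableSpace α} {ν : Measure α} {f g : α → ℝ}

/-- Turns the entropy difference into an integral of a nonnegative function: `klFun t` = t log t + 1
- t is nonnegative for t ≥ 0 and vanishes there only at 1. -/
lemma mul_klFun_div {a b : ℝ} (hb : 0 < b) :
    b * InformationTheory.klFun (a / b) = a * Real.log a - a * Real.log b + b - a := by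
  rcases eq_or_ne a 0 with rfl | ha
  · simp [InformationTheory.klFun]
  · rw [InformationTheory.klFun, Real.log_div ha hb.ne']
    field_simp

/-- Gibbs' inequality for densities, with its equality case. -/
theorem gibbs (hf : 0 ≤ f) (hg : ∀ x, 0 < g x) (hfi : Integrable f ν) (hgi : Integrable g ν)
    (hfg : ∫ x, f x ∂ν = ∫ x, g x ∂ν) (hff : Integrable (fun x => f x * Real.log (f x)) ν)
    (hflg : Integrable (fun x => f x * Real.log (g x)) ν) :
    ∫ x, f x * Real.log (g x) ∂ν ≤ ∫ x, f x * Real.log (f x) ∂ν ∧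
      (∫ x, f x * Real.log (f x) ∂ν = ∫ x, f x * Real.log (g x) ∂ν → f =ᵐ[ν] g) := by
  have h1 : Integrable (fun x => f x * Real.log (f x) - f x * Real.log (g x)) ν := hff.sub hflg
  have h2 : Integrable (fun x => f x * Real.log (f x) - f x * Real.log (g x) + g x) ν := h1.add hgi
  have hint : Integrable (fun x => g x * InformationTheory.klFun (f x / g x)) ν := by
    simp_rw [fun x => mul_klFun_div (a := f x) (hg x)]
    exact h2.sub hfi
  -- The linear terms g - f integrate to zero because the total masses agree.
  have hval : ∫ x, g x * InformationTheory.klFun (f x / g x) ∂ν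
      = ∫ x, f x * Real.log (f x) ∂ν - ∫ x, f x * Real.log (g x) ∂ν := by
    simp_rw [fun x => mul_klFun_div (a := f x) (hg x)]
    rw [integral_sub h2 hfi, integral_add h1 hgi, integral_sub hff hflg, hfg]
    ring
  have hnn : 0 ≤ fun x => g x * InformationTheory.klFun (f x / g x) := fun x =>
    mul_nonneg (hg x).le (InformationTheory.klFun_nonneg (div_nonneg (hf x) (hg x).le))
  refine ⟨by linarith [integral_nonneg (μ := ν) hnn], fun h => ?_⟩
  rw [h, sub_self, integral_eq_zero_iff_of_nonneg hnn hint] at hval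
  filter_upwards [hval] with x hx
  have := (mul_eq_zero.1 hx).resolve_left (hg x).ne'
  rw [InformationTheory.klFun_eq_zero_iff (div_nonneg (hf x) (hg x).le),
    div_eq_one_iff_eq (hg x).ne'] at this
  exact this

end Gibbs

/-! ### Densities of nondegenerate Gaussian vectors. -/

section Density

variable {ι : Type*} [Fintype ι]

/-- It suffices to compare the measures on boxes; there the indicator times the product density is
again a product over coordinates, and Fubini applies. -/
lemma pi_gaussianReal_eq_withDensity :
    Measure.pi (fun _ : ι => gaussianReal 0 1)
      = volume.withDensity fun x => ENNReal.ofReal (∏ i, gaussianPDFReal 0 1 (x i)) := by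
  refine Measure.pi_eq fun s hs => ?_
  have hφ : ∀ i, Integrable ((s i).indicator (gaussianPDFReal 0 1)) := fun i =>
    (integrable_gaussianPDFReal 0 1).indicator (hs i)
  have hind : ∀ x : ι → ℝ, (Set.univ.pi s).indicator
      (fun x => ENNReal.ofReal (∏ i, gaussianPDFReal 0 1 (x i))) x
      = ENNReal.ofReal (∏ i, (s i).indicator (gaussianPDFReal 0 1) (x i)) := by
    intro x
    by_cases hx : x ∈ Set.univ.pi s
    · rw [Set.indicator_of_mem hx]
      congr 1
      exact Finset.prod_congr rfl fun i _ => (Set.indicator_of_mem (hx i trivial) _).symm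
    · rw [Set.indicator_of_notMem hx]
      simp only [Set.mem_pi, Set.mem_univ, true_imp_iff, not_forall] at hx
      obtain ⟨i, hi⟩ := hx
      rw [Finset.prod_eq_zero (Finset.mem_univ i) (Set.indicator_of_notMem hi _),
        ENNReal.ofReal_zero]
  have hnn : ∀ i, 0 ≤ (s i).indicator (gaussianPDFReal 0 1) := fun i =>
    Set.indicator_nonneg fun x _ => gaussianPDFReal_nonneg 0 1 x
  rw [withDensity_apply _ (.univ_pi hs), ← lintegral_indicator (.univ_pi hs)]
  have hI : Integrable fun x : ι → ℝ => ∏ i, (s i).indicator (gaussianPDFReal 0 1) (x i) :=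
    .fintype_prod hφ
  simp_rw [hind]
  rw [← ofReal_integral_eq_lintegral_ofReal hI
      (.of_forall fun x => Finset.prod_nonneg fun i _ => hnn i _),
    integral_fintype_prod_volume_eq_prod,
    ENNReal.ofReal_prod_of_nonneg fun i _ => integral_nonneg (hnn i)]
  refine Finset.prod_congr rfl fun i _ => ?_
  rw [gaussianReal_apply_eq_integral 0 one_ne_zero, integral_indicator (hs i)]

@[fun_prop]
lemma continuous_mulVec_sub (m : ι → ℝ) (A : Matrix ι ι ℝ) :
    Continuous fun y : ι → ℝ => A *ᵥ (y - m) :=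
  continuous_const.matrix_mulVec (continuous_id.sub continuous_const)

@[fun_prop]
lemma continuous_add_mulVec (m : ι → ℝ) (A : Matrix ι ι ℝ) :
    Continuous fun z : ι → ℝ => m + A *ᵥ z :=
  continuous_const.add (continuous_const.matrix_mulVec continuous_id)

variable [DecidableEq ι]

/-- The density of `m + A z`, where `z` is a standard Gaussian vector and `A` is invertible. -/
def affineGaussianPDF (m : ι → ℝ) (A : Matrix ι ι ℝ) (y : ι → ℝ) : ℝ :=
  |A.det|⁻¹ * ∏ i, gaussianPDFReal 0 1 ((A⁻¹ *ᵥ (y - m)) i)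

/-- The law of `m + A z`, where `z` is a standard Gaussian vector. -/
def affineGaussian (m : ι → ℝ) (A : Matrix ι ι ℝ) : Measure (ι → ℝ) :=
  (Measure.pi fun _ : ι => gaussianReal 0 1).map fun z => m + A *ᵥ z

instance (m : ι → ℝ) (A : Matrix ι ι ℝ) : IsProbabilityMeasure (affineGaussian m A) :=
  Measure.isProbabilityMeasure_map (continuous_add_mulVec m A).aemeasurable

lemma measurable_affineGaussianPDF (m : ι → ℝ) (A : Matrix ι ι ℝ) :
    Measurable (affineGaussianPDF m A) :=
  .const_mul (Finset.measurable_prod _ fun i _ => (measurable_gaussianPDFReal 0 1).comp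
    ((measurable_pi_apply i).comp (continuous_mulVec_sub m A⁻¹).measurable)) _

lemma affineGaussianPDF_pos (m : ι → ℝ) {A : Matrix ι ι ℝ} (hA : A.det ≠ 0) (y : ι → ℝ) :
    0 < affineGaussianPDF m A y :=
  mul_pos (inv_pos.2 (abs_pos.2 hA))
    (Finset.prod_pos fun _ _ => gaussianPDFReal_pos _ _ _ one_ne_zero)

lemma map_affine_volume (m : ι → ℝ) {A : Matrix ι ι ℝ} (hA : A.det ≠ 0) :
    (volume : Measure (ι → ℝ)).map (fun z => m + A *ᵥ z)
      = ENNReal.ofReal |A.det|⁻¹ • volume := by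
  have h : (fun z : ι → ℝ => m + A *ᵥ z) = (fun z => m + z) ∘ Matrix.toLin' A := by
    ext z; simp
  have hc : Continuous (Matrix.toLin' A) := LinearMap.continuous_of_finiteDimensional _
  rw [h, ← Measure.map_map (measurable_const_add m) hc.measurable,
    Real.map_matrix_volume_pi_eq_smul_volume_pi hA, Measure.map_smul, map_add_left_eq_self,
    abs_inv]

theorem affineGaussian_eq_withDensity (m : ι → ℝ) {A : Matrix ι ι ℝ} (hA : A.det ≠ 0) :
    affineGaussian m A = volume.withDensity fun y => ENNReal.ofReal (affineGaussianPDF m A y) := by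
  have hinv : ∀ z, A⁻¹ *ᵥ ((m + A *ᵥ z) - m) = z := fun z => by
    rw [add_sub_cancel_left, Matrix.mulVec_mulVec, Matrix.nonsing_inv_mul _ hA.isUnit,
      Matrix.one_mulVec]
  have hT : Measurable fun z : ι → ℝ => m + A *ᵥ z := (continuous_add_mulVec m A).measurable
  have hF : Measurable fun y => ENNReal.ofReal (∏ i, gaussianPDFReal 0 1 ((A⁻¹ *ᵥ (y - m)) i)) :=
    (Finset.measurable_prod _ fun i _ => (measurable_gaussianPDFReal 0 1).comp
      ((measurable_pi_apply i).comp (continuous_mulVec_sub m A⁻¹).measurable)).ennreal_ofReal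
  ext s hs
  rw [affineGaussian, Measure.map_apply hT hs, pi_gaussianReal_eq_withDensity,
    withDensity_apply _ (hT hs), withDensity_apply _ hs]
  -- The constant |det A|⁻¹ is absorbed into Lebesgue measure, which becomes the image of Lebesgue
  -- measure under z ↦ m + A z.
  simp_rw [affineGaussianPDF, ENNReal.ofReal_mul (inv_nonneg.2 (abs_nonneg A.det))]
  rw [lintegral_const_mul _ hF, ← smul_eq_mul, ← lintegral_smul_measure, ← Measure.restrict_smul,
    ← map_affine_volume m hA, setLIntegral_map hs hF hT]
  simp_rw [hinv]

lemma log_affineGaussianPDF (m : ι → ℝ) {A : Matrix ι ι ℝ} (hA : A.det ≠ 0) (y : ι → ℝ) :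
    Real.log (affineGaussianPDF m A y)
      = -(Real.log |A.det| + Fintype.card ι * (1 / 2 * Real.log (2 * Real.pi)))
        - 1 / 2 * ∑ i, (A⁻¹ *ᵥ (y - m)) i ^ 2 := by
  have h1 : ∀ x, Real.log (gaussianPDFReal 0 1 x)
      = -(1 / 2 * Real.log (2 * Real.pi)) - 1 / 2 * x ^ 2 := fun x => by
    have : 0 < 2 * Real.pi := by positivity
    rw [gaussianPDFReal, Real.log_mul (by simp; positivity) (Real.exp_pos _).ne', Real.log_inv,
      Real.log_exp, Real.log_sqrt (by simp; positivity)]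
    simp
    ring
  rw [affineGaussianPDF, Real.log_mul (inv_ne_zero (abs_ne_zero.2 hA))
    (Finset.prod_ne_zero_iff.2 fun i _ => (gaussianPDFReal_pos _ _ _ one_ne_zero).ne'),
    Real.log_inv, Real.log_prod fun i _ => (gaussianPDFReal_pos _ _ _ one_ne_zero).ne']
  simp_rw [h1]
  rw [Finset.sum_sub_distrib, ← Finset.mul_sum, Finset.sum_const, Finset.card_univ, nsmul_eq_mul]
  ring

end Density

/-! ### Whitening and the maximum entropy theorem for real vectors. -/

section Whitening

variable {Ω : Type*} [MeasurableSpace Ω] {P : Measure Ω}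
  {ι : Type*} [Fintype ι] [DecidableEq ι] {Y : Ω → ι → ℝ} {A : Matrix ι ι ℝ}

/-- The vector `A⁻¹ (Y - E[Y])`. -/
def whiten (A : Matrix ι ι ℝ) (Y : Ω → ι → ℝ) (P : Measure Ω) (ω : Ω) : ι → ℝ :=
  A⁻¹ *ᵥ (Y ω - fun i => ∫ ω, Y ω i ∂P)

lemma whiten_apply (A : Matrix ι ι ℝ) (Y : Ω → ι → ℝ) (P : Measure Ω) (ω : Ω) (i : ι) :
    whiten A Y P ω i = ∑ k, A⁻¹ i k * (Y ω k - ∫ ω, Y ω k ∂P) := rfl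

lemma add_mulVec_whiten (hA : A.det ≠ 0) (ω : Ω) :
    (fun i => ∫ ω, Y ω i ∂P) + A *ᵥ whiten A Y P ω = Y ω := by
  rw [whiten, Matrix.mulVec_mulVec, Matrix.mul_nonsing_inv _ hA.isUnit, Matrix.one_mulVec,
    add_sub_cancel]

variable [IsProbabilityMeasure P]

lemma memLp_whiten (hmom : ∀ i, MemLp (fun ω => Y ω i) 2 P) (i : ι) :
    MemLp (fun ω => whiten A Y P ω i) 2 P := by
  simp_rw [whiten_apply]
  exact memLp_finsetSum _ fun k _ => ((hmom k).sub (memLp_const _)).const_mul _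

lemma integral_whiten (hmom : ∀ i, MemLp (fun ω => Y ω i) 2 P) (i : ι) :
    ∫ ω, whiten A Y P ω i ∂P = 0 := by
  have hint : ∀ k, Integrable (fun ω => Y ω k) P := fun k => (hmom k).integrable one_le_two
  simp_rw [whiten_apply]
  rw [integral_finsetSum _ fun k _ => Integrable.const_mul
    (f := fun ω => Y ω k - ∫ ω, Y ω k ∂P) ((hint k).sub (integrable_const _)) _]
  refine Finset.sum_eq_zero fun k _ => ?_
  rw [integral_const_mul, integral_sub (hint k) (integrable_const _)]
  simp

lemma covariance_whiten (hmom : ∀ i, MemLp (fun ω => Y ω i) 2 P) (hA : A.det ≠ 0)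
    (hcov : ∀ i j, cov[fun ω => Y ω i, fun ω => Y ω j; P] = (A * Aᵀ) i j) (i j : ι) :
    cov[fun ω => whiten A Y P ω i, fun ω => whiten A Y P ω j; P]
      = (1 : Matrix ι ι ℝ) i j := by
  have hint : ∀ k, Integrable (fun ω => Y ω k) P := fun k => (hmom k).integrable one_le_two
  have hL : ∀ i k, MemLp (fun ω => A⁻¹ i k * (Y ω k - ∫ ω, Y ω k ∂P)) 2 P := fun i k =>
    ((hmom k).sub (memLp_const _)).const_mul _
  have h1 : A⁻¹ * (A * Aᵀ) * A⁻¹ᵀ = 1 := by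
    rw [← Matrix.mul_assoc, Matrix.nonsing_inv_mul _ hA.isUnit, Matrix.one_mul,
      ← Matrix.transpose_mul, Matrix.nonsing_inv_mul _ hA.isUnit, Matrix.transpose_one]
  simp_rw [whiten_apply]
  rw [covariance_fun_sum_fun_sum (hL i) (hL j), ← h1, Matrix.mul_apply, Finset.sum_comm]
  refine Finset.sum_congr rfl fun l _ => ?_
  rw [Matrix.mul_apply, Finset.sum_mul]
  refine Finset.sum_congr rfl fun k _ => ?_
  rw [covariance_const_mul_left, covariance_const_mul_right, covariance_sub_const_left (hint k),
    covariance_sub_const_right (hint l), hcov, Matrix.transpose_apply]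
  ring

lemma integral_sum_sq_whiten (hmom : ∀ i, MemLp (fun ω => Y ω i) 2 P) (hA : A.det ≠ 0)
    (hcov : ∀ i j, cov[fun ω => Y ω i, fun ω => Y ω j; P] = (A * Aᵀ) i j) :
    ∫ ω, ∑ i, whiten A Y P ω i ^ 2 ∂P = Fintype.card ι := by
  rw [integral_finsetSum _ fun i _ => (memLp_whiten hmom i).integrable_sq]
  have : ∀ i, ∫ ω, whiten A Y P ω i ^ 2 ∂P = 1 := fun i => by
    have h := covariance_whiten hmom hA hcov i i
    rw [covariance, integral_whiten hmom, Matrix.one_apply_eq] at h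
    simpa [sq] using h
  simp [this]

/-- A Gaussian vector is an affine image of a standard Gaussian vector. -/
theorem HasGaussianLaw.map_eq_affineGaussian (hY : HasGaussianLaw Y P)
    (hmom : ∀ i, MemLp (fun ω => Y ω i) 2 P) (hA : A.det ≠ 0)
    (hcov : ∀ i j, cov[fun ω => Y ω i, fun ω => Y ω j; P] = (A * Aᵀ) i j) :
    P.map Y = affineGaussian (fun i => ∫ ω, Y ω i ∂P) A := by
  set m : ι → ℝ := fun i => ∫ ω, Y ω i ∂P
  have hW : HasGaussianLaw (whiten A Y P) P := by
    have h1 : HasGaussianLaw (fun ω => Y ω - m) P := by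
      constructor
      have := hY.isGaussian_map
      have h2 : P.map (fun ω => Y ω - m) = (P.map Y).map (fun y => y - m) := by
        rw [AEMeasurable.map_map_of_aemeasurable (by fun_prop) hY.aemeasurable]
        rfl
      rw [h2]
      infer_instance
    exact h1.map_fun (Matrix.toLin' A⁻¹).toContinuousLinearMap
  -- Uncorrelated coordinates of a jointly Gaussian vector are independent.
  have hind : iIndepFun (fun i ω => whiten A Y P ω i) P :=
    HasGaussianLaw.iIndepFun_of_covariance_eq_zero hW fun i j hij => by
      rw [covariance_whiten hmom hA hcov, Matrix.one_apply_ne hij]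
  have hmarg : ∀ i, P.map (fun ω => whiten A Y P ω i) = gaussianReal 0 1 := fun i => by
    rw [HasGaussianLaw.map_eq_gaussianReal (HasGaussianLaw.eval hW i), integral_whiten hmom,
      ← covariance_self (memLp_whiten hmom i).aemeasurable, covariance_whiten hmom hA hcov]
    simp
  have hlaw : P.map (whiten A Y P) = Measure.pi fun _ => gaussianReal 0 1 := by
    rw [iIndepFun_iff_map_fun_eq_pi_map fun i => (memLp_whiten hmom i).aemeasurable] at hind
    simpa only [hmarg] using hind
  rw [affineGaussian, ← hlaw, AEMeasurable.map_map_of_aemeasurable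
    (continuous_add_mulVec m A).aemeasurable hW.aemeasurable]
  congr 1
  ext1 ω
  exact (add_mulVec_whiten hA ω).symm

instance isGaussian_pi_gaussianReal :
    IsGaussian (Measure.pi fun _ : ι => gaussianReal 0 1) := by
  rw [← isGaussian_map_equiv_iff (EuclideanSpace.equiv ι ℝ).symm]
  have h : IsGaussian ((Measure.pi fun _ : ι => gaussianReal 0 1).map (WithLp.toLp 2)) := by
    rw [map_pi_eq_stdGaussian (ι := ι)]
    infer_instance
  exact h

instance isGaussian_affineGaussian (m : ι → ℝ) (A : Matrix ι ι ℝ) :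
    IsGaussian (affineGaussian m A) := by
  have h : (fun z : ι → ℝ => m + A *ᵥ z)
      = (fun z => m + z) ∘ (Matrix.toLin' A).toContinuousLinearMap := by
    ext z; simp
  rw [affineGaussian, h, ← Measure.map_map (by fun_prop) (by fun_prop)]
  infer_instance

/-- Among random vectors with covariance matrix `A Aᵀ`, exactly the Gaussian ones maximize the
differential entropy. -/
theorem real_maximum_entropy (hY : AEMeasurable Y P) (hac : P.map Y ≪ volume)
    (hmom : ∀ i, MemLp (fun ω => Y ω i) 2 P) (hA : A.det ≠ 0)
    (hcov : ∀ i j, cov[fun ω => Y ω i, fun ω => Y ω j; P] = (A * Aᵀ) i j)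
    {f : (ι → ℝ) → ℝ} (hf : f = fun ξ => (pdf Y P volume ξ).toReal) {c : ℝ}
    (hc : c = Real.log |A.det| + Fintype.card ι * (1 / 2 * Real.log (2 * Real.pi) + 1 / 2)) :
    (Integrable (fun ξ => f ξ * Real.log (f ξ)) →
      -∫ ξ, f ξ * Real.log (f ξ) ≤ c) ∧
    ((Integrable (fun ξ => f ξ * Real.log (f ξ)) ∧ -∫ ξ, f ξ * Real.log (f ξ) = c) ↔
      HasGaussianLaw Y P) := by
  set m : ι → ℝ := fun i => ∫ ω, Y ω i ∂P
  set g := affineGaussianPDF m A with hg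
  have hpdf : HasPDF Y P volume := ⟨hY, inferInstance, hac⟩
  have hgpos : ∀ y, 0 < g y := affineGaussianPDF_pos m hA
  have hgm : Measurable g := measurable_affineGaussianPDF m A
  have hγ := affineGaussian_eq_withDensity m hA
  rw [← hg] at hγ
  have hlg1 : ∫⁻ y, ENNReal.ofReal (g y) = 1 := by
    rw [← setLIntegral_univ, ← withDensity_apply _ .univ, ← hγ, measure_univ]
  have hgi : Integrable g := by
    refine ⟨hgm.aestronglyMeasurable, ?_⟩
    rw [hasFiniteIntegral_iff_ofReal (.of_forall fun y => (hgpos y).le), hlg1]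
    exact ENNReal.one_lt_top
  have hg1 : ∫ y, g y = 1 := by
    rw [integral_eq_lintegral_of_nonneg_ae (.of_forall fun y => (hgpos y).le)
      hgm.aestronglyMeasurable, hlg1, ENNReal.toReal_one]
  have hf0 : 0 ≤ f := fun ξ => hf ▸ ENNReal.toReal_nonneg
  have htr : ∀ {h : (ι → ℝ) → ℝ}, Measurable h → Integrable (fun ω => h (Y ω)) P →
      Integrable (fun ξ => f ξ * h ξ) ∧ ∫ ξ, f ξ * h ξ = ∫ ω, h (Y ω) ∂P := fun hh hi => by
    subst hf
    exact ⟨(pdf.integrable_pdf_smul_iff hh.aestronglyMeasurable).2 hi,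
      pdf.integral_pdf_smul hh.aestronglyMeasurable⟩
  have hfi : Integrable f ∧ ∫ ξ, f ξ = 1 := by
    simpa using htr (h := fun _ => 1) measurable_const (integrable_const _)
  have hlog : ∀ ω, Real.log (g (Y ω))
      = -(Real.log |A.det| + Fintype.card ι * (1 / 2 * Real.log (2 * Real.pi)))
        - 1 / 2 * ∑ i, whiten A Y P ω i ^ 2 := fun ω => log_affineGaussianPDF m hA (Y ω)
  have hsq : Integrable (fun ω => 1 / 2 * ∑ i, whiten A Y P ω i ^ 2) P :=
    (integrable_finsetSum _ fun i _ => (memLp_whiten hmom i).integrable_sq).const_mul _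
  -- No Gaussianity of Y is used: the whitened vector has expected squared norm `Fintype.card ι`,
  -- which yields the summand 1/2 per coordinate in c.
  have hflg : Integrable (fun ξ => f ξ * Real.log (g ξ)) ∧ ∫ ξ, f ξ * Real.log (g ξ) = -c := by
    have := htr (h := fun ξ => Real.log (g ξ)) (Real.measurable_log.comp hgm)
      (by simp_rw [hlog]; exact (integrable_const _).sub hsq)
    refine ⟨this.1, this.2.trans ?_⟩
    simp_rw [hlog]
    rw [integral_sub (integrable_const _) hsq, integral_const_mul,
      integral_sum_sq_whiten hmom hA hcov, hc]
    simp
    ring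
  have key := fun hff => gibbs hf0 hgpos hfi.1 hgi (hfi.2.trans hg1.symm) hff hflg.1
  rw [hflg.2] at key
  refine ⟨fun hff => by linarith [(key hff).1], fun ⟨hff, he⟩ => ⟨?_⟩, fun hG => ?_⟩
  · have hfg : f =ᵐ[volume] g := (key hff).2 (by linarith)
    have : P.map Y = affineGaussian m A := by
      rw [hγ, map_eq_withDensity_pdf Y P volume]
      refine withDensity_congr_ae ?_
      have htoReal : (fun y => ENNReal.ofReal (pdf Y P volume y).toReal) =ᵐ[volume]
        pdf Y P volume := pdf.ofReal_toReal_ae_eq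
      filter_upwards [hfg, htoReal] with y h1 h2
      rw [← h1, ← h2, hf]
    rw [this]
    infer_instance
  · have hfg : f =ᵐ[volume] g := by
      have h1 : pdf Y P volume =ᵐ[volume] fun y => ENNReal.ofReal (g y) :=
        (pdf.eq_of_map_eq_withDensity' (fun y => ENNReal.ofReal (g y))
          hgm.ennreal_ofReal.aemeasurable).1
        ((HasGaussianLaw.map_eq_affineGaussian hG hmom hA hcov).trans hγ)
      filter_upwards [h1] with y hy
      rw [hf]
      simp only [hy, ENNReal.toReal_ofReal (hgpos y).le]
    have he : (fun ξ => f ξ * Real.log (f ξ)) =ᵐ[volume] fun ξ => f ξ * Real.log (g ξ) := by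
      filter_upwards [hfg] with y hy
      rw [hy]
    exact ⟨hflg.1.congr he.symm, by rw [integral_congr_ae he, hflg.2, neg_neg]⟩

end Whitening

/-! ### Determinants of augmented covariance matrices. -/

section Determinant

variable {n : ℕ}

/-- The characteristic polynomial of `Kᴴ K` at `1`, in terms of the singular values of `K`. -/
lemma det_one_sub_conjTranspose_mul_self (K : Matrix (Fin n) (Fin n) ℂ) :
    (1 - Kᴴ * K).det = ((∏ i, (1 - singVal K i ^ 2) : ℝ) : ℂ) := by
  set T := Matrix.toEuclideanLin K
  have hn : Module.finrank ℂ (EuclideanSpace ℂ (Fin n)) = n := finrank_euclideanSpace_fin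
  have h1 : T.adjoint ∘ₗ T = Matrix.toEuclideanLin (Kᴴ * K) := by
    rw [← Matrix.toEuclideanLin_conjTranspose_eq_adjoint]
    ext; simp [T]
  have h2 : (T.adjoint ∘ₗ T).charpoly = (Kᴴ * K).charpoly := by
    rw [h1, Matrix.toEuclideanLin_eq_toLin_orthonormal, Matrix.charpoly_toLin]
  have h3 := congrArg (Polynomial.eval 1) (h2.symm.trans
    (T.isSymmetric_adjoint_comp_self.charpoly_eq hn))
  rw [Matrix.eval_charpoly, Polynomial.eval_prod] at h3
  simp only [Polynomial.eval_sub, Polynomial.eval_X, Polynomial.eval_C, map_one] at h3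
  rw [h3]
  push_cast
  refine Finset.prod_congr rfl fun i _ => ?_
  rw [← T.sq_singularValues_fin hn i, singVal]
  push_cast
  rfl

/-- An eigenvector of the adjoint of K composed with K, for the eigenvalue σ², is stretched by K by
exactly σ, so σ is at most the operator norm. -/
lemma singVal_lt_one {K : Matrix (Fin n) (Fin n) ℂ} (hK : euclOpNorm K < 1) (i : Fin n) :
    singVal K i < 1 := by
  set T := Matrix.toEuclideanLin K
  have hn : Module.finrank ℂ (EuclideanSpace ℂ (Fin n)) = n := finrank_euclideanSpace_fin
  obtain ⟨v, hv⟩ := (T.hasEigenvalue_adjoint_comp_self_sq_singularValues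
    (n := i) (by rw [hn]; exact i.2)).exists_hasEigenvector
  have hv0 : 0 < ‖v‖ := norm_pos_iff.2 hv.2
  have h1 : ‖T v‖ ^ 2 = (singVal K i * ‖v‖) ^ 2 := by
    have h := congrArg (inner ℂ v) hv.apply_eq_smul
    rw [LinearMap.comp_apply, LinearMap.adjoint_inner_right, inner_smul_right,
      inner_self_eq_norm_sq_to_K, inner_self_eq_norm_sq_to_K] at h
    rw [mul_pow, singVal]
    exact_mod_cast h
  have h2 : ‖T v‖ = singVal K i * ‖v‖ :=
    (sq_eq_sq₀ (norm_nonneg _) (mul_nonneg (T.singularValues_nonneg i) hv0.le)).1 h1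
  have h3 : ‖T v‖ ≤ euclOpNorm K * ‖v‖ := (Matrix.toEuclideanCLM (𝕜 := ℂ) K).le_opNorm v
  by_contra! h
  have : 1 * ‖v‖ ≤ singVal K i * ‖v‖ := mul_le_mul_of_nonneg_right h hv0.le
  have : euclOpNorm K * ‖v‖ < 1 * ‖v‖ := mul_lt_mul_of_pos_right hK hv0
  linarith

lemma one_sub_sq_singVal_pos {K : Matrix (Fin n) (Fin n) ℂ} (hK : euclOpNorm K < 1) (i : Fin n) :
    0 < 1 - singVal K i ^ 2 := by
  have h0 : 0 ≤ singVal K i := LinearMap.singularValues_nonneg _ _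
  nlinarith [singVal_lt_one hK i]

/-- The determinant of the augmented covariance matrix of a complex random vector, in terms of a Cholesky factor. -/
lemma det_augmented {B C Q : Matrix (Fin n) (Fin n) ℂ} (hB : IsUnit B.det) (hC : C = B * Bᴴ)
    (hQ : Qᵀ = Q) :
    (Matrix.fromBlocks C Q (Q.map conj) (C.map conj)).det
      = C.det ^ 2 * ((∏ i, (1 - singVal (coherenceMat B Q) i ^ 2) : ℝ) : ℂ) := by
  set K := coherenceMat B Q with hK
  have hBt : Bᵀ.det = B.det := B.det_transpose
  have hKQ : Q = B * K * Bᵀ := by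
    have h1 : (B⁻¹)ᵀ * Bᵀ = 1 := by
      rw [← Matrix.transpose_mul, Matrix.mul_nonsing_inv _ hB, Matrix.transpose_one]
    rw [hK, coherenceMat, Matrix.mul_assoc B, Matrix.mul_assoc _ _ Bᵀ, h1, Matrix.mul_one,
      ← Matrix.mul_assoc, Matrix.mul_nonsing_inv _ hB, Matrix.one_mul]
  have hKt : Kᵀ = K := by
    simp only [hK, coherenceMat, Matrix.transpose_mul, Matrix.transpose_transpose, hQ,
      Matrix.mul_assoc]
  -- Symmetry of K, inherited from Q, is what makes the lower left block the adjoint of the upper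
  -- right one.
  have hKc : K.map conj = Kᴴ := by
    rw [Matrix.conjTranspose, hKt]; rfl
  have hBHc : Bᴴ.map conj = Bᵀ := by
    ext i j; simp
  have hBtc : Bᵀ.map conj = Bᴴ := rfl
  have hfac : Matrix.fromBlocks C Q (Q.map conj) (C.map conj)
      = Matrix.fromBlocks B 0 0 (B.map conj) * Matrix.fromBlocks 1 K Kᴴ 1
        * Matrix.fromBlocks Bᴴ 0 0 Bᵀ := by
    rw [hC]
    nth_rewrite 1 2 [hKQ]
    simp only [Matrix.map_mul, hKc, hBHc, hBtc, Matrix.fromBlocks_multiply, Matrix.mul_one,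
      Matrix.mul_zero, Matrix.zero_mul, add_zero, zero_add]
  have hBc : (B.map conj).det = conj B.det := (RingHom.map_det conj B).symm
  rw [hfac, Matrix.det_mul, Matrix.det_mul, Matrix.det_fromBlocks_zero₂₁,
    Matrix.det_fromBlocks_zero₂₁, Matrix.det_fromBlocks_one₁₁,
    det_one_sub_conjTranspose_mul_self, hBc, hC, Matrix.det_mul, Matrix.det_conjTranspose, hBt]
  simp only [RCLike.star_def]
  ring

/-- The determinant of a real covariance matrix, from the complex covariance matrix `C` and the
complementary covariance matrix `Q`. -/
lemma det_ofReal_eq {S₁ S₂ S₃ S₄ : Matrix (Fin n) (Fin n) ℝ} {C Q : Matrix (Fin n) (Fin n) ℂ}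
    (hC : ∀ i j, C i j = (S₁ i j + S₄ i j : ℝ) + (S₃ i j - S₂ i j : ℝ) * Complex.I)
    (hQ : ∀ i j, Q i j = (S₁ i j - S₄ i j : ℝ) + (S₃ i j + S₂ i j : ℝ) * Complex.I) :
    (4 : ℂ) ^ n * ((Matrix.fromBlocks S₁ S₂ S₃ S₄).det : ℂ)
      = (Matrix.fromBlocks C Q (Q.map conj) (C.map conj)).det := by
  -- U sends [Re x; Im x] to [x; conj x], and V is its conjugate transpose; U V = 2 in dimension 2n
  -- produces the factor 4^n.
  set U : Matrix (Fin n ⊕ Fin n) (Fin n ⊕ Fin n) ℂ :=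
    Matrix.fromBlocks 1 (Complex.I • 1) 1 (-Complex.I • 1)
  set V : Matrix (Fin n ⊕ Fin n) (Fin n ⊕ Fin n) ℂ :=
    Matrix.fromBlocks 1 1 (-Complex.I • 1) (Complex.I • 1)
  have hUV : U.det * V.det = 4 ^ n := by
    have h : U * V = (2 : ℂ) • 1 := by
      simp only [U, V, Matrix.fromBlocks_multiply]
      rw [← Matrix.fromBlocks_one, Matrix.fromBlocks_smul]
      congr 1 <;> ext i j <;> simp [Matrix.one_apply] <;> split_ifs <;> simp <;> norm_num
    rw [← Matrix.det_mul, h, Matrix.det_smul, Matrix.det_one, mul_one, Fintype.card_sum,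
      Fintype.card_fin, ← two_mul, pow_mul]
    norm_num
  have hfac : Matrix.fromBlocks C Q (Q.map conj) (C.map conj)
      = U * (Matrix.fromBlocks S₁ S₂ S₃ S₄).map Complex.ofRealHom * V := by
    simp only [U, V, Matrix.fromBlocks_map, Matrix.fromBlocks_multiply]
    congr 1 <;> ext i j <;> simp [hC, hQ] <;> ring_nf <;> simp <;> ring
  rw [hfac, Matrix.det_mul, Matrix.det_mul, ← hUV]
  have : ((Matrix.fromBlocks S₁ S₂ S₃ S₄).map Complex.ofRealHom).det
      = ((Matrix.fromBlocks S₁ S₂ S₃ S₄).det : ℂ) :=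
    (RingHom.map_det Complex.ofRealHom (Matrix.fromBlocks S₁ S₂ S₃ S₄)).symm
  rw [this]
  ring

end Determinant

/-! ### Covariances of a complex vector and of its real representation. -/

section RealRepresentation

variable {Ω : Type*} [MeasurableSpace Ω] {P : Measure Ω}

/-- The covariance matrix of a real random vector. -/
def realCov {ι : Type*} (Y : Ω → ι → ℝ) (P : Measure Ω) : Matrix ι ι ℝ :=
  Matrix.of fun i j => cov[fun ω => Y ω i, fun ω => Y ω j; P]

lemma posSemidef_realCov {ι : Type*} [Fintype ι] [IsProbabilityMeasure P] {Y : Ω → ι → ℝ}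
    (hmom : ∀ i, MemLp (fun ω => Y ω i) 2 P) : (realCov Y P).PosSemidef := by
  refine .of_dotProduct_mulVec_nonneg ?_ fun x => ?_
  · ext i j
    simp [realCov, covariance_comm]
  · have hL : ∀ i, MemLp (fun ω => x i * Y ω i) 2 P := fun i => (hmom i).const_mul _
    have h : star x ⬝ᵥ (realCov Y P *ᵥ x)
        = cov[fun ω => ∑ i, x i * Y ω i, fun ω => ∑ i, x i * Y ω i; P] := by
      rw [covariance_fun_sum_fun_sum hL hL]
      simp only [dotProduct, Matrix.mulVec, Finset.mul_sum, realCov, Matrix.of_apply,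
        covariance_const_mul_left, covariance_const_mul_right, Pi.star_apply, star_trivial]
      exact Finset.sum_congr rfl fun i _ => Finset.sum_congr rfl fun j _ => by ring
    rw [h, covariance_self (memLp_finsetSum _ fun i _ => hL i).aemeasurable]
    exact variance_nonneg _ _

open scoped MatrixOrder in
lemma exists_eq_mul_transpose {ι : Type*} [Fintype ι] [DecidableEq ι] {S : Matrix ι ι ℝ}
    (hS : S.PosSemidef) : ∃ A : Matrix ι ι ℝ, S = A * Aᵀ := by
  obtain ⟨A, hA⟩ := CStarAlgebra.nonneg_iff_eq_star_mul_self.mp hS.nonneg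
  exact ⟨Aᵀ, by rw [hA, Matrix.transpose_transpose]; rfl⟩

variable {n : ℕ} {X : Ω → Fin n → ℂ}

lemma memLp_realRep (hmom : ∀ i, MemLp (fun ω => X ω i) 2 P) (i : Fin n ⊕ Fin n) :
    MemLp (fun ω => realRep X ω i) 2 P := by
  rcases i with i | i
  · exact (hmom i).re
  · exact (hmom i).im

lemma aemeasurable_realRep (hX : AEMeasurable X P) : AEMeasurable (realRep X) P := by
  refine aemeasurable_pi_lambda _ fun i => ?_
  rcases i with i | i
  · exact Complex.measurable_re.comp_aemeasurable ((measurable_pi_apply i).comp_aemeasurable hX)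
  · exact Complex.measurable_im.comp_aemeasurable ((measurable_pi_apply i).comp_aemeasurable hX)

lemma sub_meanVec [IsProbabilityMeasure P] (hmom : ∀ i, MemLp (fun ω => X ω i) 2 P) (ω : Ω)
    (i : Fin n) :
    X ω i - meanVec X P i
      = ((realRep X ω (.inl i) - ∫ ω, realRep X ω (.inl i) ∂P : ℝ) : ℂ)
        + ((realRep X ω (.inr i) - ∫ ω, realRep X ω (.inr i) ∂P : ℝ) : ℂ) * Complex.I := by
  have hint : Integrable (fun ω => X ω i) P := (hmom i).integrable one_le_two
  have hre : ∫ ω, (X ω i).re ∂P = (∫ ω, X ω i ∂P).re := Complex.reCLM.integral_comp_comm hint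
  have him : ∫ ω, (X ω i).im ∂P = (∫ ω, X ω i ∂P).im := Complex.imCLM.integral_comp_comm hint
  apply Complex.ext <;> simp [meanVec, realRep, hre, him]

lemma integral_ofReal_add_ofReal_mul_I {f g h k : Ω → ℝ} (hf : Integrable f P)
    (hg : Integrable g P) (hh : Integrable h P) (hk : Integrable k P) :
    ∫ ω, (((f ω + g ω : ℝ) : ℂ) + ((h ω + k ω : ℝ) : ℂ) * Complex.I) ∂P
      = ((∫ ω, f ω ∂P + ∫ ω, g ω ∂P : ℝ) : ℂ)
        + ((∫ ω, h ω ∂P + ∫ ω, k ω ∂P : ℝ) : ℂ) * Complex.I := by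
  have h1 : Integrable (fun ω => f ω + g ω) P := hf.add hg
  have h2 : Integrable (fun ω => h ω + k ω) P := hh.add hk
  rw [integral_add h1.ofReal (h2.ofReal.mul_const _), integral_mul_const, integral_complex_ofReal,
    integral_complex_ofReal, integral_add hf hg, integral_add hh hk]

lemma integrable_centered_mul {ι : Type*} [IsProbabilityMeasure P] {Y : Ω → ι → ℝ}
    (hmom : ∀ i, MemLp (fun ω => Y ω i) 2 P) (i j : ι) :
    Integrable (fun ω => (Y ω i - ∫ ω, Y ω i ∂P) * (Y ω j - ∫ ω, Y ω j ∂P)) P :=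
  MemLp.integrable_mul ((hmom i).sub (memLp_const _)) ((hmom j).sub (memLp_const _))

lemma covMat_apply [IsProbabilityMeasure P] (hmom : ∀ i, MemLp (fun ω => X ω i) 2 P) (i j : Fin n) :
    covMat X P i j = (realCov (realRep X) P (.inl i) (.inl j)
        + realCov (realRep X) P (.inr i) (.inr j) : ℝ)
      + (realCov (realRep X) P (.inr i) (.inl j)
        - realCov (realRep X) P (.inl i) (.inr j) : ℝ) * Complex.I := by
  have hint := integrable_centered_mul (memLp_realRep hmom)
  have h := integral_ofReal_add_ofReal_mul_I (hint (.inl i) (.inl j)) (hint (.inr i) (.inr j))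
    (hint (.inr i) (.inl j)) (hint (.inl i) (.inr j)).neg
  simp only [Pi.neg_apply, integral_neg, ← sub_eq_add_neg] at h
  refine Eq.trans ?_ h
  rw [covMat, Matrix.of_apply]
  refine integral_congr_ae (.of_forall fun ω => ?_)
  simp only [sub_meanVec hmom]
  apply Complex.ext <;> simp <;> ring

lemma compCovMat_apply [IsProbabilityMeasure P] (hmom : ∀ i, MemLp (fun ω => X ω i) 2 P)
    (i j : Fin n) :
    compCovMat X P i j = (realCov (realRep X) P (.inl i) (.inl j)
        - realCov (realRep X) P (.inr i) (.inr j) : ℝ)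
      + (realCov (realRep X) P (.inr i) (.inl j)
        + realCov (realRep X) P (.inl i) (.inr j) : ℝ) * Complex.I := by
  have hint := integrable_centered_mul (memLp_realRep hmom)
  have h := integral_ofReal_add_ofReal_mul_I (hint (.inl i) (.inl j))
    (hint (.inr i) (.inr j)).neg (hint (.inr i) (.inl j)) (hint (.inl i) (.inr j))
  simp only [Pi.neg_apply, integral_neg, ← sub_eq_add_neg] at h
  refine Eq.trans ?_ h
  rw [compCovMat, Matrix.of_apply]
  refine integral_congr_ae (.of_forall fun ω => ?_)
  simp only [sub_meanVec hmom]
  apply Complex.ext <;> simp <;> ring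

lemma transpose_compCovMat : (compCovMat X P)ᵀ = compCovMat X P := by
  ext i j
  simp [compCovMat, mul_comm]

/-- The determinant of the covariance matrix of the real representation. -/
theorem det_realCov_realRep [IsProbabilityMeasure P] (hmom : ∀ i, MemLp (fun ω => X ω i) 2 P)
    {B : Matrix (Fin n) (Fin n) ℂ} (hB : IsGenCholeskyFactor B (covMat X P)) :
    4 ^ n * (realCov (realRep X) P).det = (covMat X P).det.re ^ 2
      * ∏ i, (1 - singVal (coherenceMat B (compCovMat X P)) i ^ 2) := by
  have hBdet : IsUnit B.det := by
    have h := hB.1.det_pos.ne'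
    rw [hB.2, Matrix.det_mul] at h
    exact (left_ne_zero_of_mul h).isUnit
  -- The determinant of a positive definite matrix is positive, hence real, so the identity descends
  -- to ℝ.
  have hre : (((covMat X P).det.re : ℝ) : ℂ) = (covMat X P).det :=
    (Complex.eq_re_of_ofReal_le (r := 0) (by simpa using hB.1.det_pos.le)).symm
  have h := det_ofReal_eq (S₁ := (realCov (realRep X) P).toBlocks₁₁)
    (S₂ := (realCov (realRep X) P).toBlocks₁₂) (S₃ := (realCov (realRep X) P).toBlocks₂₁)
    (S₄ := (realCov (realRep X) P).toBlocks₂₂) (covMat_apply hmom) (compCovMat_apply hmom)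
  rw [Matrix.fromBlocks_toBlocks, det_augmented hBdet hB.2 transpose_compCovMat, ← hre] at h
  exact_mod_cast h

end RealRepresentation

end ComplexRV

end

/-! ### The complex maximum entropy theorem. -/

theorem mainTheorem2 {Ω : Type*} [MeasurableSpace Ω] (P : Measure Ω) [IsProbabilityMeasure P]
    {n : ℕ} (b : ℝ) (hb : 1 < b)
    (X : Ω → Fin n → ℂ) (hX : AEMeasurable X P)
    (hac : P.map (ComplexRV.realRep X) ≪ volume)
    (hmom : ∀ i, MemLp (fun ω => X ω i) 2 P)
    (hC : IsUnit (ComplexRV.covMat X P))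
    (B : Matrix (Fin n) (Fin n) ℂ)
    (hB : ComplexRV.IsGenCholeskyFactor B (ComplexRV.covMat X P))
    (hnorm : ComplexRV.euclOpNorm
      (ComplexRV.coherenceMat B (ComplexRV.compCovMat X P)) < 1) :
    (ComplexRV.HasEntropy b X P → ComplexRV.entropy b X P ≤ ComplexRV.entropyBound b X P B) ∧
    ((ComplexRV.HasEntropy b X P ∧ ComplexRV.entropy b X P = ComplexRV.entropyBound b X P B) ↔
      ComplexRV.IsGaussianVec X P) := by
  have hlb : 0 < Real.log b := Real.log_pos hb
  set S := ComplexRV.realCov (ComplexRV.realRep X) P with hS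
  set K := ComplexRV.coherenceMat B (ComplexRV.compCovMat X P) with hK
  set D := (ComplexRV.covMat X P).det.re with hD
  have hpos := ComplexRV.one_sub_sq_singVal_pos hnorm
  have hprod : 0 < ∏ i, (1 - ComplexRV.singVal K i ^ 2) := Finset.prod_pos fun i _ => hpos i
  have hDpos : 0 < D := (Complex.pos_iff.1 hB.1.det_pos).1
  have hdet : 4 ^ n * S.det = D ^ 2 * ∏ i, (1 - ComplexRV.singVal K i ^ 2) :=
    ComplexRV.det_realCov_realRep hmom hB
  have hmom' := ComplexRV.memLp_realRep hmom
  obtain ⟨A, hA⟩ := ComplexRV.exists_eq_mul_transpose (ComplexRV.posSemidef_realCov hmom')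
  rw [← hS] at hA
  have hSA : S.det = A.det ^ 2 := by rw [hA, Matrix.det_mul, Matrix.det_transpose, sq]
  -- The norm condition enters here: with all λ_i < 1 the real covariance is nonsingular.
  have hA0 : A.det ≠ 0 := by
    intro h
    rw [hSA, h] at hdet
    have : 0 < D ^ 2 * ∏ i, (1 - ComplexRV.singVal K i ^ 2) := by positivity
    rw [← hdet] at this
    simp at this
  have hlogA : n * Real.log 4 + 2 * Real.log |A.det|
      = 2 * Real.log D + ∑ i, Real.log (1 - ComplexRV.singVal K i ^ 2) := by
    have h := congrArg Real.log hdet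
    rw [hSA, ← sq_abs A.det, Real.log_mul (by positivity) (by positivity), Real.log_pow,
      Real.log_pow, Real.log_mul (by positivity) hprod.ne', Real.log_pow,
      Real.log_prod fun i _ => (hpos i).ne'] at h
    exact_mod_cast h
  -- The n log 2 coming from 4^n turns the real constant n log(2πe) into n log(πe). Multiplying by
  -- log b passes to natural logarithms.
  have hbound : Real.log b * ComplexRV.entropyBound b X P B = Real.log |A.det|
      + Fintype.card (Fin n ⊕ Fin n) * (1 / 2 * Real.log (2 * Real.pi) + 1 / 2) := by
    have h4 : Real.log 4 = 2 * Real.log 2 := by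
      rw [show (4 : ℝ) = 2 ^ 2 by norm_num, Real.log_pow]; norm_num
    have hπ : (((Real.pi * Real.exp 1 : ℝ) : ℂ) • ComplexRV.covMat X P).det.re
        = (Real.pi * Real.exp 1) ^ n * D := by
      rw [Matrix.det_smul, Fintype.card_fin, ← Complex.ofReal_pow, Complex.re_ofReal_mul]
    rw [ComplexRV.entropyBound, hπ]
    simp only [Real.logb, ← Finset.sum_div]
    rw [Real.log_mul (by positivity) hDpos.ne', Real.log_pow,
      Real.log_mul Real.pi_ne_zero (Real.exp_pos 1).ne', Real.log_exp,
      Real.log_mul two_ne_zero Real.pi_ne_zero, Fintype.card_sum, Fintype.card_fin]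
    field_simp
    push_cast
    rw [h4] at hlogA
    linarith
  have key := ComplexRV.real_maximum_entropy (ComplexRV.aemeasurable_realRep hX) hac hmom' hA0
    (fun i j => by rw [← hA]; rfl) rfl hbound
  have hfun : ComplexRV.entropyIntegrand b X P = fun ξ =>
      (pdf (ComplexRV.realRep X) P volume ξ).toReal
        * Real.log (pdf (ComplexRV.realRep X) P volume ξ).toReal / Real.log b := by
    ext ξ
    rw [ComplexRV.entropyIntegrand, Real.logb, mul_div_assoc]
  have hent : ComplexRV.HasEntropy b X P ↔ Integrable fun ξ =>
      (pdf (ComplexRV.realRep X) P volume ξ).toReal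
        * Real.log (pdf (ComplexRV.realRep X) P volume ξ).toReal := by
    rw [ComplexRV.HasEntropy, hfun]
    simp only [div_eq_mul_inv]
    exact integrable_mul_const_iff (inv_ne_zero hlb.ne').isUnit _
  have hval : -∫ ξ, (pdf (ComplexRV.realRep X) P volume ξ).toReal
        * Real.log (pdf (ComplexRV.realRep X) P volume ξ).toReal
      = Real.log b * ComplexRV.entropy b X P := by
    rw [ComplexRV.entropy, hfun, integral_div]
    field_simp
  rw [hval, ← hent, mul_le_mul_iff_right₀ hlb, mul_right_inj' hlb.ne'] at key
  exact key
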